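/- A \emph{ranked alphabet} is a finite set $\Sigma$ of symbols together with a rank $\mathrm{rk}(f)\in\mathbb{N}$ for each $f\in\Sigma$; let $\Sigma_k$ be the set of symbols of rank $k$. For a finite set $V$ (a leaf alphabet, disjoint from $\Sigma$), $T_\Sigma(V)$ is the smallest set of trees that contains $V$ and contains $f(t_1,\dots,t_k)$ whenever $f\in\Sigma_k$ and $t_1,\dots,t_k$ are in the set. A \emph{tree language} is a subset of $T_\Sigma(V)$. Let $X_k=\{x_1,\dots,x_k\}$ be formal variables; $t[t_1,\dots,t_k]$ is the result of replacing each occurrence of $x_i$ in $t$ by $t_i$. A tree homomorphism $\varphi\colon T_\Sigma(V)\to T_\Delta(Y)$ is presented by a map $\varphi_V\colon V\to T_\Delta(Y)$ and maps $\varphi_k\colon\Sigma_k\to T_\Delta(Y\cup X_k)$, with $\varphi(v)=\varphi_V(v)$ and $\varphi(f(t_1,\dots,t_k))=\varphi_k(f)[\varphi(t_1),\dots,\varphi(t_k)]$. It is \emph{quasi-alphabetic} if $\varphi_V(v)\in Y$ for every $v\in V$ and, for every $k$ and $f\in\Sigma_k$, each of $x_1,\dots,x_k$ occurs exactly once in $\varphi_k(f)$,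 and $\varphi_k(f)=g(u_1,\dots,u_n)$ for some $g\in\Delta_n$ and $u_1,\dots,u_n\in Y\cup X_k$. A tree language $L\subseteq T_\Sigma(V)$ is \emph{recognizable} if it is the language of a finite-state tree automaton, that is, a finite set $Q$ of states, a set $I\subseteq Q$, and rules of the forms $q\to v$ ($v\in V$) and $q\to f(q_1,\dots,q_k)$ ($f\in\Sigma_k$); a tree is in the language if it can be processed successfully by the rules starting from some state of $I$ at the root. It is \emph{algebraic} (context-free) if it is generated by a context-free tree grammar, that is, a ranked alphabet $N$ of nonterminals, a start symbol $A_0\in N_0$, and finitely many rules $A(x_1,\dots,x_k)\to r$ with $A\in N_k$ and $r\in T_{N\cup\Sigma}(V\cup X_k)$; a derivation step replaces, at an arbitrary position, a subtree $A(t_1,\dots,t_k)$ by $r[t_1,\dots,t_k]$, and the language consists of the trees in $T_\Sigma(V)$ that are derivable from $A_0$. A relation $\tau\subseteq T_\Sigma(V)\times T_\Delta(Y)$ is \emph{quasi-alphabetic} if $\tau=\{(\varphi(t),\psi(t)) \mid t\in L\}$ for some ranked alphabet $\Gamma$, finite set $Z$, quasi-alphabetic tree homomorphisms $\varphi\colon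 T_\Gamma(Z)\to T_\Sigma(V)$ and $\psi\colon T_\Gamma(Z)\to T_\Delta(Y)$, and recognizable $L\subseteq T_\Gamma(Z)$. \textbf{Corollary.} Let $\tau\subseteq T_\Sigma(V)\times T_\Delta(Y)$ be a quasi-alphabetic relation, let $L\subseteq T_\Sigma(V)$, and let $L\tau=\{u\in T_\Delta(Y) \mid (t,u)\in\tau\text{ for some }t\in L\}$. If $L$ is recognizable, then $L\tau$ is recognizable. If $L$ is algebraic, then $L\tau$ is algebraic. -/

import Mathlib

/-- A ranked alphabet: a finite set of symbols together with a rank for each symbol. -/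
structure RankedAlphabet where
  Sym : Type*
  finite_sym : Finite Sym
  rk : Sym → ℕ

attribute [instance] RankedAlphabet.finite_sym

/-- The disjoint union of two ranked alphabets. -/
def RankedAlphabet.sum (N S : RankedAlphabet) : RankedAlphabet where
  Sym := N.Sym ⊕ S.Sym
  finite_sym := inferInstance
  rk := Sum.elim N.rk S.rk

/-- `RTree S V` is the set `T_S(V)` of all `S`-trees indexed by the leaf alphabet `V`. -/
inductive RTree (S : RankedAlphabet) (V : Type*) where
  | leaf (v : V) : RTree S V
  | node (f : S.Sym) (ts : Fin (S.rk f) → RTree S V) : RTree S V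

namespace RTree

/-- Simultaneous replacement of every leaf `v` by the tree `σ v`. -/
def bind {S : RankedAlphabet} {V W : Type*} (σ : V → RTree S W) : RTree S V → RTree S W
  | leaf v => σ v
  | node f ts => node f (fun i => bind σ (ts i))

/-- `t[t₁, …, tₙ]` for a tree `t` over the leaves `V` and the formal variables `x₁, …, xₙ`, where
the variables are represented by `Fin n`. -/
def subst {S : RankedAlphabet} {V : Type*} {n : ℕ} (t : RTree S (V ⊕ Fin n))
    (ts : Fin n → RTree S V) : RTree S V :=
  t.bind (Sum.elim leaf ts)

open Classical in
/-- The number of occurrences of the leaf `x` in a tree. -/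
noncomputable def count {S : RankedAlphabet} {V : Type*} (x : V) : RTree S V → ℕ
  | leaf v => if v = x then 1 else 0
  | node _ ts => ∑ i, count x (ts i)

/-- A tree over `S`, seen as a tree over the disjoint union of `N` and `S`. -/
def embed (N : RankedAlphabet) {S : RankedAlphabet} {V : Type*} : RTree S V → RTree (N.sum S) V
  | leaf v => leaf v
  | node f ts => node (S := N.sum S) (Sum.inr f) (fun i => embed N (ts i))

end RTree

/-! ### Tree homomorphisms -/

/-- The presentation of a tree homomorphism `T_S(V) → T_D(Y)`: the images of the leaves and, for
each symbol `f` of rank `k`, a tree in `T_D(Y ∪ X_k)`. -/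
structure TreeHom (S : RankedAlphabet) (V : Type*) (D : RankedAlphabet) (Y : Type*) where
  onLeaf : V → RTree D Y
  onSym : (f : S.Sym) → RTree D (Y ⊕ Fin (S.rk f))

namespace TreeHom

/-- The mapping `T_S(V) → T_D(Y)` given by a presentation. -/
def apply {S : RankedAlphabet} {V : Type*} {D : RankedAlphabet} {Y : Type*}
    (φ : TreeHom S V D Y) : RTree S V → RTree D Y
  | .leaf v => φ.onLeaf v
  | .node f ts => (φ.onSym f).subst (fun i => φ.apply (ts i))

/-- Every variable `x₁, …, x_k` occurs at most once in the image of a symbol of rank `k`. -/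
def IsLinear {S : RankedAlphabet} {V : Type*} {D : RankedAlphabet} {Y : Type*}
    (φ : TreeHom S V D Y) : Prop :=
  ∀ (f : S.Sym) (i : Fin (S.rk f)), (φ.onSym f).count (Sum.inr i) ≤ 1

/-- Every variable `x₁, …, x_k` occurs at least once in the image of a symbol of rank `k`. -/
def IsComplete {S : RankedAlphabet} {V : Type*} {D : RankedAlphabet} {Y : Type*}
    (φ : TreeHom S V D Y) : Prop :=
  ∀ (f : S.Sym) (i : Fin (S.rk f)), 1 ≤ (φ.onSym f).count (Sum.inr i)

/-- Quasi-alphabetic homomorphisms: linear and complete, leaves are mapped to leaves, and each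
symbol of rank `k` is mapped into `D(Y ∪ X_k)`, that is, to an output symbol all of whose direct
subtrees are elements of `Y ∪ X_k`. -/
structure IsQuasiAlphabetic {S : RankedAlphabet} {V : Type*} {D : RankedAlphabet} {Y : Type*}
    (φ : TreeHom S V D Y) : Prop where
  linear : φ.IsLinear
  complete : φ.IsComplete
  onLeaf_mem : ∀ v : V, ∃ y : Y, φ.onLeaf v = .leaf y
  onSym_mem : ∀ f : S.Sym, ∃ (g : D.Sym) (us : Fin (D.rk g) → Y ⊕ Fin (S.rk f)),
    φ.onSym f = .node g (fun i => .leaf (us i))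

end TreeHom

/-! ### Recognizable tree languages -/

/-- A (nondeterministic, top-down) finite-state tree automaton over `T_S(V)`. Its rules are of the
form `q → v` with `v ∈ V`, and `q → f(q₁, …, q_k)` with `f` of rank `k`. -/
structure TreeAutomaton (S : RankedAlphabet) (V : Type*) where
  State : Type
  finite_state : Finite State
  leafRules : Set (State × V)
  symRules : Set (State × (f : S.Sym) × (Fin (S.rk f) → State))
  final : Set State

/-- `M.Accepts q t`: the automaton processes the tree `t` successfully from the state `q` at the
root. -/
inductive TreeAutomaton.Accepts {S : RankedAlphabet} {V : Type*} (M : TreeAutomaton S V) :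
    M.State → RTree S V → Prop
  | leaf (q : M.State) (v : V) (h : (q, v) ∈ M.leafRules) : Accepts M q (.leaf v)
  | node (q : M.State) (f : S.Sym) (qs : Fin (S.rk f) → M.State)
      (ts : Fin (S.rk f) → RTree S V) (h : (q, ⟨f, qs⟩) ∈ M.symRules)
      (hts : ∀ i, Accepts M (qs i) (ts i)) : Accepts M q (.node f ts)

/-- The tree language recognized by an automaton. -/
def TreeAutomaton.language {S : RankedAlphabet} {V : Type*} (M : TreeAutomaton S V) :
    Set (RTree S V) :=
  {t | ∃ q ∈ M.final, M.Accepts q t}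

/-- Recognizable tree languages. -/
def IsRecognizableTreeLanguage {S : RankedAlphabet} {V : Type*} (L : Set (RTree S V)) : Prop :=
  ∃ M : TreeAutomaton S V, M.language = L

/-! ### Algebraic tree languages -/

/-- A context-free tree grammar generating trees in `T_S(V)`: a ranked alphabet of nonterminals, a
start symbol of rank `0`, and finitely many rules `A(x₁, …, x_k) → r`, where `A` is a nonterminal of
rank `k` and `r` is a tree over nonterminals and terminals with leaves in `V ∪ X_k`. -/
structure ContextFreeTreeGrammar (S : RankedAlphabet) (V : Type*) where
  N : RankedAlphabet.{0}
  start : N.Sym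
  rk_start : N.rk start = 0
  rules : Set ((A : N.Sym) × RTree (N.sum S) (V ⊕ Fin (N.rk A)))
  finite_rules : rules.Finite

namespace ContextFreeTreeGrammar

/-- One (unrestricted) derivation step: at an arbitrary position of the sentential form, a subtree
`A(t₁, …, t_k)` is replaced by `r[t₁, …, t_k]`, where `A(x₁, …, x_k) → r` is a rule. -/
inductive Step {S : RankedAlphabet} {V : Type*} (G : ContextFreeTreeGrammar S V) :
    RTree (G.N.sum S) V → RTree (G.N.sum S) V → Prop
  | root (A : G.N.Sym) (r : RTree (G.N.sum S) (V ⊕ Fin (G.N.rk A))) (h : ⟨A, r⟩ ∈ G.rules)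
      (ts : Fin (G.N.rk A) → RTree (G.N.sum S) V) :
      Step G (.node (S := G.N.sum S) (Sum.inl A) ts) (r.subst ts)
  | child (f : (G.N.sum S).Sym) (ts : Fin ((G.N.sum S).rk f) → RTree (G.N.sum S) V)
      (i : Fin ((G.N.sum S).rk f)) (s : RTree (G.N.sum S) V) (h : Step G (ts i) s) :
      Step G (.node f ts) (.node f (Function.update ts i s))

/-- The sentential form consisting of the start symbol only. -/
def startTree {S : RankedAlphabet} {V : Type*} (G : ContextFreeTreeGrammar S V) :
    RTree (G.N.sum S) V :=
  .node (S := G.N.sum S) (Sum.inl G.start) (fun i => (Fin.cast G.rk_start i).elim0)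

/-- The tree language generated by a grammar: all trees over terminals only that are derivable from
the start symbol. -/
def language {S : RankedAlphabet} {V : Type*} (G : ContextFreeTreeGrammar S V) :
    Set (RTree S V) :=
  {t | Relation.ReflTransGen G.Step G.startTree (t.embed G.N)}

end ContextFreeTreeGrammar

/-- Algebraic (context-free) tree languages. -/
def IsAlgebraicTreeLanguage {S : RankedAlphabet} {V : Type*} (L : Set (RTree S V)) : Prop :=
  ∃ G : ContextFreeTreeGrammar S V, G.language = L

/-! ### Quasi-alphabetic relations -/

/-- The tree transformation `{(tφ, tψ) | t ∈ L}` defined by the bimorphism `(φ, L, ψ)`. -/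
def bimorphismRel {C : RankedAlphabet} {Z : Type*} {S : RankedAlphabet} {V : Type*}
    {D : RankedAlphabet} {Y : Type*} (φ : TreeHom C Z S V) (L : Set (RTree C Z))
    (ψ : TreeHom C Z D Y) : SetRel (RTree S V) (RTree D Y) :=
  {p | ∃ t ∈ L, p = (φ.apply t, ψ.apply t)}

/-- Quasi-alphabetic relations: the tree transformations defined by bimorphisms `(φ, L, ψ)` with
`φ` and `ψ` quasi-alphabetic and `L` recognizable. -/
def IsQuasiAlphabeticRel {S : RankedAlphabet} {V : Type*} {D : RankedAlphabet} {Y : Type*}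
    (τ : SetRel (RTree S V) (RTree D Y)) : Prop :=
  ∃ (C : RankedAlphabet.{0}) (Z : Type) (_ : Finite Z) (φ : TreeHom C Z S V) (L : Set (RTree C Z))
    (ψ : TreeHom C Z D Y), φ.IsQuasiAlphabetic ∧ IsRecognizableTreeLanguage L ∧ ψ.IsQuasiAlphabetic ∧
      τ = bimorphismRel φ L ψ

/-! Images of symbols are one symbol deep and contain each variable exactly once
(`existsUnique_of_onSym_eq`). If `φ` sends `f` to `g(…)` and `ψ` sends it to `h(…)`, the variables
match certain children of `g` with certain children of `h`; every other child is a leaf inserted by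
`φ` or by `ψ`.

For recognizable languages, a product automaton runs on output trees. It carries a state of each
given automaton, guesses `f` at every node, checks the leaves inserted by `φ` on the spot, and
checks those inserted by `ψ` with extra states.

For algebraic languages, a product grammar equips each nonterminal with an automaton state and each
parameter with one copy per state, since copies of an argument may be read from different states.
The invariant is that the translation of a sentential form `s` at `p` generates exactly the `ψ t`
with `t` accepted from `p` and `φ t` generated by `s`. The obstacle is a child of `g` that holds a
leaf: it is absent from the output, yet the corresponding argument must be able to generate it. So
nonterminals also record the leaves that their arguments generate. This works because the leaves
generated by `t[ts]` depend only on `t` and on the leaves generated by `ts` (`openLeafSet_eq`).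
Translation then commutes with rule application (`translateOpen_subst`), and derivations correspond
in both directions. -/

namespace RTree

theorem bind_bind {S : RankedAlphabet} {V W X : Type*} (σ : V → RTree S W) (τ : W → RTree S X)
    (t : RTree S V) : (t.bind σ).bind τ = t.bind (fun v => (σ v).bind τ) := by
  induction t with
  | leaf v => rfl
  | node f ts ih => simp only [bind, ih]

theorem subst_bind {S : RankedAlphabet} {V : Type*} {m n : ℕ} (r : RTree S (V ⊕ Fin m))
    (us : Fin m → RTree S (V ⊕ Fin n)) (ts : Fin n → RTree S V) :
    (r.bind (Sum.elim (fun v => leaf (Sum.inl v)) us)).subst ts =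
      r.subst (fun i => (us i).subst ts) := by
  rw [subst, bind_bind, subst]
  congr 1
  funext x
  cases x <;> rfl

end RTree

/-! ### Shape of quasi-alphabetic images -/

namespace TreeHom

variable {S : RankedAlphabet} {V : Type*} {D : RankedAlphabet} {Y : Type*}

/-- On a tree of height one the occurrence count is the number of children equal to the variable;
linearity and completeness force it to be one. -/
theorem IsQuasiAlphabetic.existsUnique_of_onSym_eq {φ : TreeHom S V D Y}
    (hφ : φ.IsQuasiAlphabetic) {f : S.Sym} {g : D.Sym} {us : Fin (D.rk g) → Y ⊕ Fin (S.rk f)}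
    (h : φ.onSym f = .node g (fun i => .leaf (us i))) (i : Fin (S.rk f)) :
    ∃! j, us j = Sum.inr i := by
  classical
  have h1 := hφ.linear f i
  have h2 := hφ.complete f i
  rw [h] at h1 h2
  have h3 : ∑ j, (if us j = Sum.inr i then 1 else 0) = 1 := by
    simp only [RTree.count] at h1 h2
    convert le_antisymm h1 h2
  rw [← Finset.card_filter, Finset.card_eq_one] at h3
  obtain ⟨j, hj⟩ := h3
  refine ⟨j, by simpa using hj.ge (Finset.mem_singleton_self j), fun k hk => ?_⟩
  have : k ∈ Finset.univ.filter (fun j => us j = Sum.inr i) := by simpa using hk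
  rw [hj] at this
  simpa using this

theorem apply_node_of_onSym_eq {φ : TreeHom S V D Y} {f : S.Sym} {g : D.Sym}
    {us : Fin (D.rk g) → Y ⊕ Fin (S.rk f)} (h : φ.onSym f = .node g (fun i => .leaf (us i)))
    (ts : Fin (S.rk f) → RTree S V) :
    φ.apply (.node f ts) =
      .node g (fun j => Sum.elim RTree.leaf (fun i => φ.apply (ts i)) (us j)) := by
  simp [apply, h, RTree.subst, RTree.bind]

end TreeHom

/-! ### Automata with a single initial state -/

namespace TreeAutomaton

variable {S : RankedAlphabet} {V : Type*} (M : TreeAutomaton S V)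

theorem accepts_leaf_iff {M : TreeAutomaton S V} {q : M.State} {v : V} :
    M.Accepts q (.leaf v) ↔ (q, v) ∈ M.leafRules :=
  ⟨fun h => by cases h; assumption, .leaf q v⟩

theorem accepts_node_iff {M : TreeAutomaton S V} {q : M.State} {f : S.Sym}
    {ts : Fin (S.rk f) → RTree S V} :
    M.Accepts q (.node f ts) ↔ ∃ qs, (q, ⟨f, qs⟩) ∈ M.symRules ∧ ∀ i, M.Accepts (qs i) (ts i) := by
  constructor
  · intro h
    cases h with
    | node _ _ qs _ h hts => exact ⟨qs, h, hts⟩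
  · rintro ⟨qs, h, hts⟩
    exact .node q f qs ts h hts

/-- The automaton with an additional state that simulates all initial states. -/
def addInitial : TreeAutomaton S V where
  State := Option M.State
  finite_state := have := M.finite_state; inferInstance
  leafRules := {x | ∃ q, (q, x.2) ∈ M.leafRules ∧ (x.1 = some q ∨ x.1 = none ∧ q ∈ M.final)}
  symRules := {x | ∃ q f qs, (q, ⟨f, qs⟩) ∈ M.symRules ∧ x.2 = ⟨f, fun i => some (qs i)⟩ ∧
    (x.1 = some q ∨ x.1 = none ∧ q ∈ M.final)}
  final := {none}

theorem addInitial_accepts_some_iff (q : M.State) (t : RTree S V) :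
    M.addInitial.Accepts (some q) t ↔ M.Accepts q t := by
  induction t generalizing q with
  | leaf v => simp [accepts_leaf_iff, addInitial]
  | node f ts ih =>
    refine accepts_node_iff.trans (Iff.trans ?_ accepts_node_iff.symm)
    constructor
    · rintro ⟨qs, ⟨q', f', qs', h, he, hq⟩, hts⟩
      obtain rfl : q = q' := by simpa using hq
      cases he
      exact ⟨qs', h, fun i => (ih i _).1 (hts i)⟩
    · rintro ⟨qs, h, hts⟩
      exact ⟨fun i => some (qs i), ⟨q, f, qs, h, rfl, Or.inl rfl⟩, fun i => (ih i _).2 (hts i)⟩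

theorem addInitial_accepts_none_iff (t : RTree S V) :
    M.addInitial.Accepts none t ↔ t ∈ M.language := by
  cases t with
  | leaf v => simp [accepts_leaf_iff, addInitial, language, and_comm]
  | node f ts =>
    refine accepts_node_iff.trans ?_
    constructor
    · rintro ⟨qs, ⟨q', f', qs', h, he, hq⟩, hts⟩
      cases he
      exact ⟨q', by simpa using hq, accepts_node_iff.2 ⟨qs', h,
        fun i => (M.addInitial_accepts_some_iff _ _).1 (hts i)⟩⟩
    · rintro ⟨q, hq, h⟩
      obtain ⟨qs, h, hts⟩ := accepts_node_iff.1 h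
      exact ⟨fun i => some (qs i), ⟨q, f, qs, h, rfl, Or.inr ⟨rfl, hq⟩⟩,
        fun i => (M.addInitial_accepts_some_iff _ _).2 (hts i)⟩

/-- Every automaton is equivalent to one with a single initial state. -/
theorem exists_accepts_iff_mem_language :
    ∃ (M' : TreeAutomaton S V) (q : M'.State), ∀ t, M'.Accepts q t ↔ t ∈ M.language :=
  ⟨M.addInitial, none, M.addInitial_accepts_none_iff⟩

end TreeAutomaton

/-! ### Outermost big-step semantics of grammars -/

namespace ContextFreeTreeGrammar

variable {S : RankedAlphabet} {V : Type*} (G : ContextFreeTreeGrammar S V)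

/-- Big-step semantics of a grammar: the terminal trees generated by a sentential form. -/
inductive Generates : RTree (G.N.sum S) V → RTree S V → Prop
  | leaf (v : V) : Generates (.leaf v) (.leaf v)
  | terminal (g : S.Sym) (ts : Fin (S.rk g) → RTree (G.N.sum S) V)
      (us : Fin (S.rk g) → RTree S V) (h : ∀ i, Generates (ts i) (us i)) :
      Generates (.node (S := G.N.sum S) (Sum.inr g) ts) (.node g us)
  | nonterminal (A : G.N.Sym) (r : RTree (G.N.sum S) (V ⊕ Fin (G.N.rk A))) (hr : ⟨A, r⟩ ∈ G.rules)
      (ts : Fin (G.N.rk A) → RTree (G.N.sum S) V) (u : RTree S V) (h : Generates (r.subst ts) u) :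
      Generates (.node (S := G.N.sum S) (Sum.inl A) ts) u

variable {G}

theorem generates_leaf_iff {v : V} {u : RTree S V} : G.Generates (.leaf v) u ↔ u = .leaf v := by
  constructor
  · intro h
    cases h
    rfl
  · rintro rfl
    exact .leaf v

theorem generates_terminal_iff {g : S.Sym} {ts : Fin (S.rk g) → RTree (G.N.sum S) V}
    {u : RTree S V} : G.Generates (.node (S := G.N.sum S) (Sum.inr g) ts) u ↔
      ∃ us, u = .node g us ∧ ∀ i, G.Generates (ts i) (us i) := by
  constructor
  · intro h
    cases h with
    | terminal _ _ us h => exact ⟨us, rfl, h⟩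
  · rintro ⟨us, rfl, h⟩
    exact .terminal g ts us h

theorem generates_nonterminal_iff {A : G.N.Sym} {ts : Fin (G.N.rk A) → RTree (G.N.sum S) V}
    {u : RTree S V} : G.Generates (.node (S := G.N.sum S) (Sum.inl A) ts) u ↔
      ∃ r : RTree (G.N.sum S) (V ⊕ Fin (G.N.rk A)), ⟨A, r⟩ ∈ G.rules ∧
        G.Generates (r.subst ts) u := by
  constructor
  · intro h
    cases h with
    | nonterminal _ r hr _ _ h => exact ⟨r, hr, h⟩
  · rintro ⟨r, hr, h⟩
    exact .nonterminal A r hr ts u h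

/-- Monotonicity of generation in the substituted trees, for generated trees in a class that is
closed under direct subtrees. -/
theorem Generates.subst_mono {n : ℕ} {W : Set (RTree S V)}
    (hW : ∀ g us, RTree.node g us ∈ W → ∀ i, us i ∈ W) {ts ts' : Fin n → RTree (G.N.sum S) V}
    (h : ∀ i, ∀ u ∈ W, G.Generates (ts i) u → G.Generates (ts' i) u)
    {t : RTree (G.N.sum S) (V ⊕ Fin n)} {u : RTree S V} (hu : u ∈ W)
    (ht : G.Generates (t.subst ts) u) : G.Generates (t.subst ts') u := by
  generalize hs : t.subst ts = s at ht
  induction ht generalizing t with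
  | leaf v =>
    cases t with
    | leaf x =>
      cases x with
      | inl v' => cases hs; exact .leaf v
      | inr i =>
        have hs : ts i = _ := hs
        exact h i _ hu (hs ▸ .leaf v)
    | node f us => cases hs
  | terminal g us us' h1 ih =>
    cases t with
    | leaf x =>
      cases x with
      | inl v' => cases hs
      | inr i =>
        have hs : ts i = _ := hs
        exact h i _ hu (hs ▸ .terminal g us us' h1)
    | node f vs =>
      cases hs
      exact .terminal g _ us' (fun i => ih i (hW g us' hu i) rfl)
  | nonterminal A r hr us u h1 ih =>
    cases t with
    | leaf x =>
      cases x with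
      | inl v' => cases hs
      | inr i =>
        have hs : ts i = _ := hs
        exact h i _ hu (hs ▸ .nonterminal A r hr us u h1)
    | node f vs =>
      cases hs
      refine .nonterminal A r hr _ u ?_
      -- The rewritten tree `r[vs[ts]]` is again an instance, namely of the open tree `r[vs]`, so
      -- the induction hypothesis applies to it.
      have := ih (t := r.bind (Sum.elim (fun v => .leaf (Sum.inl v)) vs)) hu
        (RTree.subst_bind r vs ts)
      exact (RTree.subst_bind r vs ts') ▸ this

/-- A step inside an argument cannot enlarge what that argument generates, and generation is
monotone in the arguments, so an inner step can be postponed past the outer expansion. -/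
theorem Step.generates {s s' : RTree (G.N.sum S) V} (h : G.Step s s') {u : RTree S V}
    (hu : G.Generates s' u) : G.Generates s u := by
  induction h generalizing u with
  | root A r hr ts => exact .nonterminal A r hr ts u hu
  | child f ts i s h ih =>
    have key : ∀ j u, G.Generates (Function.update ts i s j) u → G.Generates (ts j) u := by
      intro j u hj
      by_cases hji : j = i
      · subst hji
        rw [Function.update_self] at hj
        exact ih hj
      · rwa [Function.update_of_ne hji] at hj
    cases f with
    | inl A =>
      obtain ⟨r, hr, h2⟩ := generates_nonterminal_iff.1 hu
      exact .nonterminal A r hr _ u (h2.subst_mono (W := Set.univ) (fun _ _ _ _ => trivial)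
        (fun j u _ => key j u) trivial)
    | inr g =>
      obtain ⟨us, rfl, h2⟩ := generates_terminal_iff.1 hu
      exact .terminal g _ us (fun j => key j _ (h2 j))

theorem generates_embed (u : RTree S V) : G.Generates (u.embed G.N) u := by
  induction u with
  | leaf v => exact .leaf v
  | node f ts ih => exact .terminal f _ ts ih

theorem reflTransGen_step_node (f : (G.N.sum S).Sym)
    {ts us : Fin ((G.N.sum S).rk f) → RTree (G.N.sum S) V}
    (h : ∀ i, Relation.ReflTransGen G.Step (ts i) (us i)) :
    Relation.ReflTransGen G.Step (.node f ts) (.node f us) := by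
  classical
  have single : ∀ (ts : Fin ((G.N.sum S).rk f) → RTree (G.N.sum S) V) (i) (s),
      Relation.ReflTransGen G.Step (ts i) s →
      Relation.ReflTransGen G.Step (.node f ts) (.node f (Function.update ts i s)) := by
    intro ts i s hs
    induction hs with
    | refl => rw [Function.update_eq_self]
    | tail _ hst ih =>
      refine ih.tail ?_
      convert Step.child f (Function.update ts i _) i _ ?_ using 2
      · rw [Function.update_idem]
      · rwa [Function.update_self]
  -- Children are rewritten one at a time; `A` collects those already done.
  have key : ∀ A : Finset (Fin ((G.N.sum S).rk f)),
      Relation.ReflTransGen G.Step (.node f ts) (.node f (A.piecewise us ts)) := by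
    intro A
    induction A using Finset.induction with
    | empty => rw [Finset.piecewise_empty]
    | insert a A ha ih =>
      rw [Finset.piecewise_insert]
      refine ih.trans (single _ _ _ ?_)
      rw [Finset.piecewise_eq_of_notMem _ _ _ ha]
      exact h a
  simpa using key Finset.univ

theorem Generates.reflTransGen {s : RTree (G.N.sum S) V} {u : RTree S V} (h : G.Generates s u) :
    Relation.ReflTransGen G.Step s (u.embed G.N) := by
  induction h with
  | leaf v => exact .refl
  | terminal g ts us h ih => exact reflTransGen_step_node (Sum.inr g) ih
  | nonterminal A r hr ts u h ih => exact .head (.root A r hr ts) ih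

theorem mem_language_iff {u : RTree S V} : u ∈ G.language ↔ G.Generates G.startTree u := by
  refine ⟨fun h => ?_, Generates.reflTransGen⟩
  have h : Relation.ReflTransGen G.Step G.startTree (u.embed G.N) := h
  generalize G.startTree = s at h ⊢
  induction h using Relation.ReflTransGen.head_induction_on with
  | refl => exact generates_embed u
  | head h _ ih => exact h.generates ih

end ContextFreeTreeGrammar

/-! ### Recognizable languages: the product automaton -/

namespace TreeAutomaton

variable {S : RankedAlphabet} {V : Type*} {C : RankedAlphabet} {Z : Type*} {D : RankedAlphabet}
  {Y : Type*} {K : Type} [Finite K]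

/-- The automaton recognizing the image of the language of `M` under the relation defined by the
bimorphism `(φ, B, ψ)`; the leaves in `Y` that are introduced by `ψ` are checked by states in `K`. -/
def image (M : TreeAutomaton S V) (B : TreeAutomaton C Z) (φ : TreeHom C Z S V)
    (ψ : TreeHom C Z D Y) (e : Y → K) : TreeAutomaton D Y where
  State := (M.State × B.State) ⊕ K
  finite_state := have := M.finite_state; have := B.finite_state; inferInstance
  leafRules := {x | x.1 = Sum.inr (e x.2) ∨ ∃ q p z v, x.1 = Sum.inl (q, p) ∧
    (p, z) ∈ B.leafRules ∧ φ.onLeaf z = .leaf v ∧ (q, v) ∈ M.leafRules ∧ ψ.onLeaf z = .leaf x.2}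
  symRules := {x | ∃ (q : M.State) (p : B.State) (f : C.Sym) (qs : Fin (C.rk f) → B.State)
    (g : S.Sym) (us : Fin (S.rk g) → V ⊕ Fin (C.rk f)) (rs : Fin (S.rk g) → M.State)
    (pos : Fin (C.rk f) → Fin (S.rk g)) (h : D.Sym) (ws : Fin (D.rk h) → Y ⊕ Fin (C.rk f)),
    (p, ⟨f, qs⟩) ∈ B.symRules ∧ (q, ⟨g, rs⟩) ∈ M.symRules ∧
    φ.onSym f = .node g (fun j => .leaf (us j)) ∧ ψ.onSym f = .node h (fun l => .leaf (ws l)) ∧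
    -- `pos i` is a child of `g` that holds the variable `i`. Children holding leaves are checked
    -- here, as they have no counterpart in the output.
    (∀ i, us (pos i) = Sum.inr i) ∧ (∀ j v, us j = Sum.inl v → (rs j, v) ∈ M.leafRules) ∧
    x = (Sum.inl (q, p), ⟨h, fun l =>
      Sum.elim (fun y => Sum.inr (e y)) (fun i => Sum.inl (rs (pos i), qs i)) (ws l)⟩)}
  final := {x | ∃ q ∈ M.final, ∃ p ∈ B.final, x = Sum.inl (q, p)}

variable {M : TreeAutomaton S V} {B : TreeAutomaton C Z} {φ : TreeHom C Z S V}
  {ψ : TreeHom C Z D Y} {e : Y → K}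

theorem image_accepts_inr {k : K} {o : RTree D Y} :
    (image M B φ ψ e).Accepts (Sum.inr k) o ↔ ∃ y, e y = k ∧ o = .leaf y := by
  constructor
  · intro h
    cases o with
    | leaf y =>
      rcases accepts_leaf_iff.1 h with h | ⟨q, p, z, v, h, _⟩
      · exact ⟨y, (Sum.inr_injective h).symm, rfl⟩
      · cases h
    | node g os =>
      obtain ⟨qs, ⟨q, p, f, _, _, _, _, _, _, _, _, _, _, _, _, _, h⟩, _⟩ := accepts_node_iff.1 h
      cases congrArg Prod.fst h
  · rintro ⟨y, rfl, rfl⟩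
    exact accepts_leaf_iff.2 (Or.inl rfl)

theorem image_accepts_inl_of (hφ : φ.IsQuasiAlphabetic) (hψ : ψ.IsQuasiAlphabetic)
    {t : RTree C Z} {q : M.State} {p : B.State} (hp : B.Accepts p t)
    (hq : M.Accepts q (φ.apply t)) : (image M B φ ψ e).Accepts (Sum.inl (q, p)) (ψ.apply t) := by
  induction t generalizing q p with
  | leaf z =>
    obtain ⟨v, hv⟩ := hφ.onLeaf_mem z
    obtain ⟨y, hy⟩ := hψ.onLeaf_mem z
    simp only [TreeHom.apply, hv, hy] at hq ⊢
    exact accepts_leaf_iff.2 (Or.inr ⟨q, p, z, v, rfl, accepts_leaf_iff.1 hp, hv,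
      accepts_leaf_iff.1 hq, hy⟩)
  | node f ts ih =>
    obtain ⟨g, us, hg⟩ := hφ.onSym_mem f
    obtain ⟨h, ws, hh⟩ := hψ.onSym_mem f
    have hus := hφ.existsUnique_of_onSym_eq hg
    rw [TreeHom.apply_node_of_onSym_eq hg] at hq
    rw [TreeHom.apply_node_of_onSym_eq hh]
    obtain ⟨qs, hqs, hts⟩ := accepts_node_iff.1 hp
    obtain ⟨rs, hrs, hus'⟩ := accepts_node_iff.1 hq
    choose pos hpos _ using hus
    refine accepts_node_iff.2 ⟨_, ⟨q, p, f, qs, g, us, rs, pos, h, ws, hqs, hrs, hg, hh, hpos,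
      fun j v hj => ?_, rfl⟩, fun l => ?_⟩
    · have := hus' j
      rw [hj] at this
      exact accepts_leaf_iff.1 this
    · cases ws l with
      | inl y => exact accepts_leaf_iff.2 (Or.inl rfl)
      | inr i =>
        have := hus' (pos i)
        rw [hpos] at this
        exact ih i (hts i) this

/-- Completeness of `ψ` provides, for each variable, an output child from which the corresponding
subtree of the preimage is recovered; linearity makes that child the only one to match. -/
theorem exists_of_image_accepts_inl (hφ : φ.IsQuasiAlphabetic) (hψ : ψ.IsQuasiAlphabetic)
    (he : e.Injective) {o : RTree D Y} {q : M.State} {p : B.State}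
    (ho : (image M B φ ψ e).Accepts (Sum.inl (q, p)) o) :
    ∃ t, B.Accepts p t ∧ M.Accepts q (φ.apply t) ∧ ψ.apply t = o := by
  induction o generalizing q p with
  | leaf y =>
    rcases accepts_leaf_iff.1 ho with h | ⟨q', p', z, v, h, hp, hv, hq, hy⟩
    · cases h
    · cases h
      refine ⟨.leaf z, accepts_leaf_iff.2 hp, ?_, hy⟩
      simp only [TreeHom.apply, hv]
      exact accepts_leaf_iff.2 hq
  | node h os ih =>
    obtain ⟨sts, ⟨q', p', f, qs, g, us, rs, pos, h', ws, hp, hq, hg, hh, hpos, hv, hx⟩, hos⟩ :=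
      accepts_node_iff.1 ho
    cases hx
    have hws := hψ.existsUnique_of_onSym_eq hh
    have hus := hφ.existsUnique_of_onSym_eq hg
    have key : ∀ i, ∃ t, B.Accepts (qs i) t ∧ M.Accepts (rs (pos i)) (φ.apply t) ∧
        ∀ l, ws l = Sum.inr i → ψ.apply t = os l := by
      intro i
      obtain ⟨l, hl, hl'⟩ := hws i
      have := hos l
      simp only [hl, Sum.elim_inr] at this
      obtain ⟨t, ht1, ht2, ht3⟩ := ih l this
      exact ⟨t, ht1, ht2, fun l' h => by rw [hl' l' h, ht3]⟩
    choose ts ht1 ht2 ht3 using key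
    refine ⟨.node f ts, accepts_node_iff.2 ⟨qs, hp, ht1⟩, ?_, ?_⟩
    · rw [TreeHom.apply_node_of_onSym_eq hg]
      refine accepts_node_iff.2 ⟨rs, hq, fun j => ?_⟩
      cases hj : us j with
      | inl v => exact accepts_leaf_iff.2 (hv j v hj)
      | inr i =>
        -- Linearity of `φ`: the variable occurs only at `pos i`, whose state is the one checked on
        -- the output.
        rw [(hus i).unique hj (hpos i)]
        exact ht2 i
    · rw [TreeHom.apply_node_of_onSym_eq hh]
      congr 1
      funext l
      have := hos l
      cases hl : ws l with
      | inl y =>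
        simp only [hl, Sum.elim_inl] at this
        obtain ⟨y', hy, ho⟩ := image_accepts_inr.1 this
        rw [ho, he hy]
        rfl
      | inr i => exact ht3 i l hl

end TreeAutomaton

theorem IsRecognizableTreeLanguage.image_bimorphismRel {S : RankedAlphabet} {V : Type*}
    {C : RankedAlphabet} {Z : Type*} {D : RankedAlphabet} {Y : Type*} [Finite Y]
    {φ : TreeHom C Z S V} {ψ : TreeHom C Z D Y} {L₀ : Set (RTree C Z)} {L : Set (RTree S V)}
    (hL : IsRecognizableTreeLanguage L) (hφ : φ.IsQuasiAlphabetic) (hψ : ψ.IsQuasiAlphabetic)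
    (hL₀ : IsRecognizableTreeLanguage L₀) :
    IsRecognizableTreeLanguage ((bimorphismRel φ L₀ ψ).image L) := by
  obtain ⟨M, rfl⟩ := hL
  obtain ⟨B, rfl⟩ := hL₀
  -- States must lie in `Type`, while `Y` may live in any universe, so states record indices of
  -- leaves.
  have he := (Finite.equivFin Y).injective
  refine ⟨M.image B φ ψ (Finite.equivFin Y), ?_⟩
  ext o
  constructor
  · rintro ⟨_, ⟨q, hq, p, hp, rfl⟩, ho⟩
    obtain ⟨t, ht1, ht2, rfl⟩ := TreeAutomaton.exists_of_image_accepts_inl hφ hψ he ho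
    exact ⟨φ.apply t, ⟨q, hq, ht2⟩, t, ⟨p, hp, ht1⟩, rfl⟩
  · rintro ⟨s, ⟨q, hq, hs⟩, t, ⟨p, hp, ht⟩, h⟩
    cases h
    exact ⟨Sum.inl (q, p), ⟨q, hq, p, hp, rfl⟩, TreeAutomaton.image_accepts_inl_of hφ hψ ht hs⟩

/-! ### Algebraic languages: the product grammar -/

namespace ContextFreeTreeGrammar

variable {S : RankedAlphabet} {V : Type*} {C : RankedAlphabet.{0}} {Z : Type} {D : RankedAlphabet}
  {Y : Type*} {K : Type}

/-- The leaves generated by a sentential form, encoded by `e`. -/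
def leafSet (G : ContextFreeTreeGrammar S V) (e : V → K) (s : RTree (G.N.sum S) V) : Set K :=
  {k | ∃ v, e v = k ∧ G.Generates s (.leaf v)}

/-- The leaves generated by every instance of `t` whose arguments generate the leaves `σ`. -/
def openLeafSet (G : ContextFreeTreeGrammar S V) (e : V → K) {n : ℕ} (σ : Fin n → Set K)
    (t : RTree (G.N.sum S) (V ⊕ Fin n)) : Set K :=
  -- All of `K` if no arguments realize `σ`; this is harmless, since only trees annotated with
  -- actual leaf sets matter.
  {k | ∀ ts, (∀ i, G.leafSet e (ts i) = σ i) → k ∈ G.leafSet e (t.subst ts)}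

theorem mem_leafSet_iff {G : ContextFreeTreeGrammar S V} {e : V → K} (he : e.Injective)
    {s : RTree (G.N.sum S) V} {v : V} : e v ∈ G.leafSet e s ↔ G.Generates s (.leaf v) :=
  ⟨fun ⟨_, h1, h2⟩ => he h1 ▸ h2, fun h => ⟨v, rfl, h⟩⟩

/-- To generate a leaf, an instance needs nothing but leaves from its arguments. This is
`subst_mono` for the class of leaves, which is vacuously closed under direct subtrees. -/
theorem openLeafSet_eq {G : ContextFreeTreeGrammar S V} {e : V → K} (he : e.Injective) {n : ℕ}
    {σ : Fin n → Set K} (t : RTree (G.N.sum S) (V ⊕ Fin n)) {ts : Fin n → RTree (G.N.sum S) V}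
    (hts : ∀ i, G.leafSet e (ts i) = σ i) :
    G.openLeafSet e σ t = G.leafSet e (t.subst ts) := by
  refine Set.Subset.antisymm (fun k hk => hk ts hts) ?_
  rintro k ⟨v, rfl, hv⟩ ts' hts'
  refine ⟨v, rfl, hv.subst_mono (W := Set.range RTree.leaf) ?_ ?_ ⟨v, rfl⟩⟩
  · rintro g us ⟨v, h⟩
    cases h
  · rintro i _ ⟨v, rfl⟩ h
    rwa [← mem_leafSet_iff he, hts', ← hts, mem_leafSet_iff he]

/-- A numbering of the parameters of the nonterminals of the product grammar: one parameter for
each state and each original parameter. -/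
noncomputable def paramEquiv (P : Type) [Finite P] (n : ℕ) : P × Fin n ≃ Fin (Nat.card (P × Fin n)) :=
  Finite.equivFin _

/-- The nonterminals of the product grammar: nonterminals of the given grammar, annotated with a
state and the leaves that the arguments generate; nonterminals that choose among transitions
for a terminal symbol of rank `n`; nonterminals that choose among leaves. -/
noncomputable def productAlphabet (N : RankedAlphabet.{0}) (S C : RankedAlphabet) (Z P K : Type) [Finite Z]
    [Finite P] [Finite K] : RankedAlphabet.{0} where
  Sym := ((A : N.Sym) × P × (Fin (N.rk A) → Set K)) ⊕
    -- Indexed by ranks rather than by terminal symbols: nonterminals must lie in `Type`, and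
    -- `S.Sym` need not.
    ((n : Set.range S.rk) × Set ((f : C.Sym) × (Fin (C.rk f) → P × Fin n))) ⊕ Set Z
  finite_sym := inferInstance
  rk := Sum.elim (fun a => Nat.card (P × Fin (N.rk a.1)))
    (Sum.elim (fun a => Nat.card (P × Fin a.1)) (fun _ => 0))

variable [Finite Z] [Finite K] (G : ContextFreeTreeGrammar S V) (B : TreeAutomaton C Z)
  [Finite B.State] (φ : TreeHom C Z S V) (ψ : TreeHom C Z D Y) (e : V → K)

noncomputable abbrev productSum (D : RankedAlphabet) : RankedAlphabet :=
  (productAlphabet G.N S C Z B.State K).sum D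

/-- The leaves that the automaton accepts from `p` and that `φ` maps to `v`. -/
def leafOptions (v : V) (p : B.State) : Set Z :=
  {z | (p, z) ∈ B.leafRules ∧ φ.onLeaf z = .leaf v}

/-- The transitions from `p` that are compatible with the symbol `g` whose direct subtrees generate
the leaves `δ`. -/
def symOptions (g : S.Sym) (p : B.State) (δ : Fin (S.rk g) → Set K) :
    Set ((f : C.Sym) × (Fin (C.rk f) → B.State × Fin (S.rk g))) :=
  {x | (p, ⟨x.1, fun i => (x.2 i).1⟩) ∈ B.symRules ∧
    ∃ us : Fin (S.rk g) → V ⊕ Fin (C.rk x.1), φ.onSym x.1 = .node g (fun j => .leaf (us j)) ∧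
      (∀ i, us (x.2 i).2 = Sum.inr i) ∧ ∀ j v, us j = Sum.inl v → e v ∈ δ j}

/-- The translation at `p` of a nonterminal whose arguments generate the leaves `δ`. -/
noncomputable def nonterminalNode {W : Type*} (A : G.N.Sym) (p : B.State) (δ : Fin (G.N.rk A) → Set K)
    (ts : Fin (Nat.card (B.State × Fin (G.N.rk A))) → RTree (productSum (K := K) G B D) W) :
    RTree (productSum (K := K) G B D) W :=
  .node (S := productSum G B D) (Sum.inl (Sum.inl ⟨A, p, δ⟩)) ts

/-- The translation at `p` of a terminal symbol whose arguments generate the leaves `δ`. -/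
noncomputable def symNode {W : Type*} (g : S.Sym) (p : B.State) (δ : Fin (S.rk g) → Set K)
    (ts : Fin (Nat.card (B.State × Fin (S.rk g))) → RTree (productSum (K := K) G B D) W) :
    RTree (productSum (K := K) G B D) W :=
  .node (S := productSum G B D)
    (Sum.inl (Sum.inr (Sum.inl ⟨⟨S.rk g, g, rfl⟩, symOptions B φ e g p δ⟩))) ts

/-- The translation of a sentential form at a state. -/
noncomputable def translate {X W : Type*} (lf : X → B.State → RTree (productSum (K := K) G B D) W)
    (dl : RTree (G.N.sum S) X → Set K) :
    RTree (G.N.sum S) X → B.State → RTree (productSum (K := K) G B D) W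
  | .leaf x, p => lf x p
  | .node (Sum.inl A) ts, p =>
    nonterminalNode G B A p (fun i => dl (ts i)) (fun k =>
      translate lf dl (ts ((paramEquiv _ _).symm k).2) ((paramEquiv _ _).symm k).1)
  | .node (Sum.inr g) ts, p =>
    symNode G B φ e g p (fun i => dl (ts i)) (fun k =>
      translate lf dl (ts ((paramEquiv _ _).symm k).2) ((paramEquiv _ _).symm k).1)

/-- The translation of a leaf at a state. -/
noncomputable def translateLeaf {W : Type*} (v : V) (p : B.State) : RTree (productSum (K := K) G B D) W :=
  .node (S := productSum G B D) (Sum.inl (Sum.inr (Sum.inr (leafOptions B φ v p))))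
    (fun i : Fin 0 => i.elim0)

/-- The translation of a sentential form without parameters. -/
noncomputable def translateClosed : RTree (G.N.sum S) V → B.State → RTree (productSum (K := K) G B D) Y :=
  translate G B φ e (translateLeaf G B φ) (G.leafSet e)

/-- The translation of the right-hand side of a rule. -/
noncomputable def translateOpen {n : ℕ} (σ : Fin n → Set K) : RTree (G.N.sum S) (V ⊕ Fin n) → B.State →
    RTree (productSum (K := K) G B D) (Y ⊕ Fin (Nat.card (B.State × Fin n))) :=
  translate G B φ e (Sum.elim (translateLeaf G B φ)
    (fun i p => .leaf (Sum.inr (paramEquiv _ _ (p, i))))) (G.openLeafSet e σ)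

variable {e} in
-- Parameter `(p, i)` receives the translation of argument `i` at `p`, and the annotations agree by
-- `openLeafSet_eq`. Hence a rule of `G` may be applied before or after translating.
theorem translateOpen_subst (he : e.Injective) {n : ℕ} {σ : Fin n → Set K}
    (t : RTree (G.N.sum S) (V ⊕ Fin n)) (p : B.State) {ts : Fin n → RTree (G.N.sum S) V}
    (hts : ∀ i, G.leafSet e (ts i) = σ i) :
    (translateOpen (Y := Y) (D := D) G B φ e σ t p).subst (fun k =>
      translateClosed G B φ e (ts ((paramEquiv _ _).symm k).2) ((paramEquiv _ _).symm k).1) =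
      translateClosed G B φ e (t.subst ts) p := by
  induction t generalizing p with
  | leaf x =>
    cases x with
    | inl v =>
      refine congrArg (RTree.node _) ?_
      funext i
      exact i.elim0
    | inr i =>
      simp only [translateOpen, translate, RTree.subst, RTree.bind, Sum.elim_inr,
        Equiv.symm_apply_apply]
  | node f us ih =>
    have hl : ∀ i, G.openLeafSet e σ (us i) = G.leafSet e ((us i).subst ts) :=
      fun i => openLeafSet_eq he _ hts
    cases f with
    | inl A => exact congrArg₂ (nonterminalNode G B A p) (funext hl) (funext fun k => ih _ _)
    | inr g => exact congrArg₂ (symNode G B φ e g p) (funext hl) (funext fun k => ih _ _)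

/-- The right-hand side that outputs the image of a leaf. -/
noncomputable def leafRhs (z : Z) : RTree (productSum (K := K) G B D) (Y ⊕ Fin 0) :=
  ((ψ.onLeaf z).embed _).bind (fun y => .leaf (Sum.inl y))

/-- The right-hand side that outputs the image of a symbol. -/
noncomputable def symRhs {n : ℕ} (f : C.Sym) (θ : Fin (C.rk f) → B.State × Fin n) :
    RTree (productSum (K := K) G B D) (Y ⊕ Fin (Nat.card (B.State × Fin n))) :=
  ((ψ.onSym f).embed _).bind
    (Sum.elim (fun y => .leaf (Sum.inl y)) (fun i => .leaf (Sum.inr (paramEquiv _ _ (θ i)))))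

/-- The rules of the product grammar. -/
inductive ProductRule : (A : (productAlphabet G.N S C Z B.State K).Sym) →
    RTree (productSum (K := K) G B D) (Y ⊕ Fin ((productAlphabet G.N S C Z B.State K).rk A)) → Prop
  | nonterminal (A : G.N.Sym) (p : B.State) (σ : Fin (G.N.rk A) → Set K)
      (r : RTree (G.N.sum S) (V ⊕ Fin (G.N.rk A))) (hr : ⟨A, r⟩ ∈ G.rules) :
      ProductRule (Sum.inl ⟨A, p, σ⟩) (translateOpen G B φ e σ r p)
  | sym (n : Set.range S.rk) (O : Set ((f : C.Sym) × (Fin (C.rk f) → B.State × Fin n)))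
      (f : C.Sym) (θ : Fin (C.rk f) → B.State × Fin n) (h : ⟨f, θ⟩ ∈ O) :
      ProductRule (Sum.inr (Sum.inl ⟨n, O⟩)) (symRhs G B ψ f θ)
  | leaf (O : Set Z) (z : Z) (h : z ∈ O) : ProductRule (Sum.inr (Sum.inr O)) (leafRhs G B ψ z)

/-- The grammar generating the image of the language of `G` under the relation defined by the
bimorphism `(φ, B, ψ)`, where `B` has the initial state `p₀`. -/
noncomputable def product (p₀ : B.State) : ContextFreeTreeGrammar D Y where
  N := productAlphabet G.N S C Z B.State K
  start := Sum.inl ⟨G.start, p₀, fun i => (Fin.cast G.rk_start i).elim0⟩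
  rk_start := by
    change Nat.card (B.State × Fin (G.N.rk G.start)) = 0
    simpa using Or.inr G.rk_start
  rules := {x | ProductRule G B φ ψ e x.1 x.2}
  finite_rules := by
    have h1 : (⋃ x ∈ G.rules, Set.range
        (fun y : B.State × (Fin (G.N.rk x.1) → Set K) =>
          (⟨Sum.inl ⟨x.1, y.1, y.2⟩, translateOpen G B φ e y.2 x.2 y.1⟩ :
            (A : (productAlphabet G.N S C Z B.State K).Sym) × RTree (productSum (K := K) G B D)
              (Y ⊕ Fin ((productAlphabet G.N S C Z B.State K).rk A))))).Finite :=
      G.finite_rules.biUnion fun x _ => Set.finite_range _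
    -- Membership of the transition in the chosen set is dropped: a finite superset of the rules
    -- suffices.
    have h2 : (Set.range (fun x : ((n : Set.range S.rk) ×
        Set ((f : C.Sym) × (Fin (C.rk f) → B.State × Fin n)) ×
        ((f : C.Sym) × (Fin (C.rk f) → B.State × Fin n))) =>
          (⟨Sum.inr (Sum.inl ⟨x.1, x.2.1⟩), symRhs G B ψ x.2.2.1 x.2.2.2⟩ :
            (A : (productAlphabet G.N S C Z B.State K).Sym) × RTree (productSum (K := K) G B D)
              (Y ⊕ Fin ((productAlphabet G.N S C Z B.State K).rk A))))).Finite :=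
      Set.finite_range _
    have h3 : (Set.range (fun x : Set Z × Z =>
          (⟨Sum.inr (Sum.inr x.1), leafRhs G B ψ x.2⟩ :
            (A : (productAlphabet G.N S C Z B.State K).Sym) × RTree (productSum (K := K) G B D)
              (Y ⊕ Fin ((productAlphabet G.N S C Z B.State K).rk A))))).Finite :=
      Set.finite_range _
    refine ((h1.union h2).union h3).subset ?_
    rintro ⟨A, r⟩ h
    cases h with
    | nonterminal A p σ r hr =>
      exact Or.inl (Or.inl (Set.mem_biUnion hr ⟨(p, σ), rfl⟩))
    | sym n O f θ h => exact Or.inl (Or.inr ⟨⟨n, O, f, θ⟩, rfl⟩)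
    | leaf O z h => exact Or.inr ⟨(O, z), rfl⟩

end ContextFreeTreeGrammar

/-! ### Correctness of the product grammar -/

namespace ContextFreeTreeGrammar

variable {S : RankedAlphabet} {V : Type*} {C : RankedAlphabet.{0}} {Z : Type} {D : RankedAlphabet}
  {Y : Type*} {K : Type} [Finite Z] [Finite K] {G : ContextFreeTreeGrammar S V}
  {B : TreeAutomaton C Z} [Finite B.State] {φ : TreeHom C Z S V} {ψ : TreeHom C Z D Y} {e : V → K}
  {p₀ : B.State}

theorem product_startTree :
    (product G B φ ψ e p₀).startTree = translateClosed G B φ e G.startTree p₀ :=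
  congrArg₂ (nonterminalNode G B G.start p₀) (funext fun i => (Fin.cast G.rk_start i).elim0)
    (funext fun k => (Fin.cast (product G B φ ψ e p₀).rk_start k).elim0)

theorem generates_translateLeaf_iff (hψ : ψ.IsQuasiAlphabetic) {v : V} {p : B.State}
    {o : RTree D Y} : (product G B φ ψ e p₀).Generates (translateLeaf G B φ v p) o ↔
      ∃ z ∈ leafOptions B φ v p, o = ψ.onLeaf z := by
  have key : ∀ (z : Z) (ts : Fin 0 → RTree (productSum (K := K) G B D) Y),
      (product G B φ ψ e p₀).Generates ((leafRhs G B ψ z).subst ts) o ↔ o = ψ.onLeaf z := by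
    intro z ts
    obtain ⟨y, hy⟩ := hψ.onLeaf_mem z
    simp only [leafRhs, hy]
    exact generates_leaf_iff
  refine generates_nonterminal_iff.trans ⟨?_, ?_⟩
  · rintro ⟨r, hr, h⟩
    have hr : ProductRule G B φ ψ e _ r := hr
    cases hr with
    | leaf _ z hz => exact ⟨z, hz, (key z _).1 h⟩
  · rintro ⟨z, hz, h⟩
    exact ⟨leafRhs G B ψ z, .leaf _ z hz, (key z _).2 h⟩

theorem generates_nonterminalNode_iff {A : G.N.Sym} {p : B.State} {δ : Fin (G.N.rk A) → Set K}
    {ts : Fin (Nat.card (B.State × Fin (G.N.rk A))) → RTree (productSum (K := K) G B D) Y}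
    {o : RTree D Y} : (product G B φ ψ e p₀).Generates (nonterminalNode G B A p δ ts) o ↔
      ∃ r : RTree (G.N.sum S) (V ⊕ Fin (G.N.rk A)), ⟨A, r⟩ ∈ G.rules ∧
        (product G B φ ψ e p₀).Generates ((translateOpen G B φ e δ r p).subst ts) o := by
  refine generates_nonterminal_iff.trans ⟨?_, ?_⟩
  · rintro ⟨r, hr, h⟩
    have hr : ProductRule G B φ ψ e _ r := hr
    cases hr with
    | nonterminal _ _ _ r hr' => exact ⟨r, hr', h⟩
  · rintro ⟨r, hr, h⟩
    exact ⟨_, .nonterminal A p δ r hr, h⟩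

theorem generates_symNode_iff {g : S.Sym} {p : B.State} {δ : Fin (S.rk g) → Set K}
    {ts : Fin (Nat.card (B.State × Fin (S.rk g))) → RTree (productSum (K := K) G B D) Y}
    {o : RTree D Y} : (product G B φ ψ e p₀).Generates (symNode G B φ e g p δ ts) o ↔
      ∃ f θ, ⟨f, θ⟩ ∈ symOptions B φ e g p δ ∧
        (product G B φ ψ e p₀).Generates ((symRhs G B ψ f θ).subst ts) o := by
  refine generates_nonterminal_iff.trans ⟨?_, ?_⟩
  · rintro ⟨r, hr, h⟩
    have hr : ProductRule G B φ ψ e _ r := hr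
    cases hr with
    | sym _ _ f θ hf => exact ⟨f, θ, hf, h⟩
  · rintro ⟨f, θ, hf, h⟩
    exact ⟨symRhs G B ψ f θ, .sym ⟨S.rk g, g, rfl⟩ _ f θ hf, h⟩

theorem symRhs_subst {n : ℕ} {f : C.Sym} {θ : Fin (C.rk f) → B.State × Fin n} {h : D.Sym}
    {ws : Fin (D.rk h) → Y ⊕ Fin (C.rk f)} (hh : ψ.onSym f = .node h (fun l => .leaf (ws l)))
    (ts : Fin (Nat.card (B.State × Fin n)) → RTree (productSum (K := K) G B D) Y) :
    (symRhs G B ψ f θ).subst ts = .node (S := productSum (K := K) G B D) (Sum.inr h)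
      (fun l => Sum.elim RTree.leaf (fun i => ts (paramEquiv _ _ (θ i))) (ws l)) := by
  simp only [symRhs, hh, RTree.embed, RTree.bind, RTree.subst]
  congr 1
  funext l
  cases ws l <;> rfl

/-- Since `φ` sends leaves to leaves and symbols to nodes, each terminal generated by `G` exposes a
symbol of `t`; nonterminal steps leave `t` unchanged and are covered by `translateOpen_subst`. -/
theorem generates_translateClosed_of (hφ : φ.IsQuasiAlphabetic) (hψ : ψ.IsQuasiAlphabetic)
    (he : e.Injective) {s : RTree (G.N.sum S) V} {t : RTree C Z} {p : B.State}
    (hs : G.Generates s (φ.apply t)) (ht : B.Accepts p t) :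
    (product G B φ ψ e p₀).Generates (translateClosed G B φ e s p) (ψ.apply t) := by
  generalize hu : φ.apply t = u at hs
  induction hs generalizing t p with
  | leaf v =>
    cases t with
    | leaf z =>
      exact (generates_translateLeaf_iff hψ).2 ⟨z, ⟨TreeAutomaton.accepts_leaf_iff.1 ht, hu⟩, rfl⟩
    | node f ts =>
      obtain ⟨g, us, hg⟩ := hφ.onSym_mem f
      rw [TreeHom.apply_node_of_onSym_eq hg] at hu
      cases hu
  | terminal g ss us hss ih =>
    cases t with
    | leaf z =>
      obtain ⟨v, hv⟩ := hφ.onLeaf_mem z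
      simp only [TreeHom.apply, hv] at hu
      cases hu
    | node f ts =>
      obtain ⟨g', vs, hg⟩ := hφ.onSym_mem f
      obtain ⟨h, ws, hh⟩ := hψ.onSym_mem f
      obtain ⟨qs, hqs, hts⟩ := TreeAutomaton.accepts_node_iff.1 ht
      rw [TreeHom.apply_node_of_onSym_eq hg] at hu
      cases hu
      choose pos hpos _ using hφ.existsUnique_of_onSym_eq hg
      refine generates_symNode_iff.2 ⟨f, fun i => (qs i, pos i), ⟨hqs, vs, hg, hpos, ?_⟩, ?_⟩
      -- This child leaves no trace in the output; the recorded leaf set certifies that it can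
      -- generate `v`.
      · intro j v hj
        have := hss j
        simp only [hj] at this
        exact (mem_leafSet_iff he).2 this
      · rw [symRhs_subst hh, TreeHom.apply_node_of_onSym_eq hh]
        refine .terminal (G := product G B φ ψ e p₀) h _ _ (fun l => ?_)
        cases ws l with
        | inl y => exact .leaf y
        | inr i =>
          simp only [Sum.elim_inr, Equiv.symm_apply_apply]
          exact ih (pos i) (hts i) (by beta_reduce; rw [hpos]; rfl)
  | nonterminal A r hr ss u h ih =>
    refine generates_nonterminalNode_iff.2 ⟨r, hr, ?_⟩
    have := ih ht hu
    rwa [← translateOpen_subst G B φ he r p (fun i => rfl)] at this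

/-- A translated terminal is first rewritten to a tree rooted at an output symbol, which is not
itself a translation. The second conjunct carries the induction hypothesis through this intermediate
tree to its children. -/
theorem exists_of_generates_translateClosed (hφ : φ.IsQuasiAlphabetic) (hψ : ψ.IsQuasiAlphabetic)
    (he : e.Injective) {w : RTree ((product G B φ ψ e p₀).N.sum D) Y} {o : RTree D Y}
    (hw : (product G B φ ψ e p₀).Generates w o) :
    (∀ s p, w = translateClosed G B φ e s p →
      ∃ t, G.Generates s (φ.apply t) ∧ B.Accepts p t ∧ ψ.apply t = o) ∧
    (∀ h ws os, w = .node (S := productSum (K := K) G B D) (Sum.inr h) ws → o = .node h os →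
      ∀ l s p, ws l = translateClosed G B φ e s p →
        ∃ t, G.Generates s (φ.apply t) ∧ B.Accepts p t ∧ ψ.apply t = os l) := by
  induction hw with
  | leaf y =>
    refine ⟨fun s p h => ?_, fun h ws os hw => by cases hw⟩
    cases s with
    | leaf v => cases h
    | node F ss => cases F <;> cases h
  | terminal h ws os hws ih =>
    refine ⟨fun s p h => ?_, fun h ws os hw ho l s p hl => ?_⟩
    · cases s with
      | leaf v => cases h
      | node F ss => cases F <;> cases h
    · cases hw
      cases ho
      exact (ih l).1 s p hl
  | nonterminal A r hr ws o h ih =>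
    refine ⟨fun s p hs => ?_, fun h ws os hw => by cases hw⟩
    have hr : ProductRule G B φ ψ e A r := hr
    cases s with
    | leaf v =>
      have h' := Generates.nonterminal (G := product G B φ ψ e p₀) A r hr ws o h
      have hs : RTree.node (S := productSum (K := K) G B D) (Sum.inl A) ws =
        translateLeaf G B φ v p := hs
      obtain ⟨z, ⟨hz, hv⟩, rfl⟩ := (generates_translateLeaf_iff hψ).1 (hs ▸ h')
      refine ⟨.leaf z, ?_, TreeAutomaton.accepts_leaf_iff.2 hz, rfl⟩
      simp only [TreeHom.apply, hv]
      exact .leaf v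
    | node F ss =>
      cases F with
      | inl A' =>
        cases hs
        cases hr with
        | nonterminal _ _ _ r hr' =>
          obtain ⟨t, ht, hpt⟩ := ih.1 _ p (translateOpen_subst G B φ he r p (fun i => rfl))
          exact ⟨t, .nonterminal A' r hr' ss _ ht, hpt⟩
      | inr g =>
        cases hs
        cases hr with
        | sym _ _ f θ hf =>
          obtain ⟨hp, us, hg, hpos, hv⟩ := hf
          obtain ⟨h', vs, hh⟩ := hψ.onSym_mem f
          have hsub := symRhs_subst (G := G) (K := K) (θ := θ) hh (fun k =>
            translateClosed G B φ e (ss ((paramEquiv _ _).symm k).2) ((paramEquiv _ _).symm k).1)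
          obtain ⟨os, rfl, hos⟩ := (generates_terminal_iff (G := product G B φ ψ e p₀)).1
            ((congrArg (fun w => (product G B φ ψ e p₀).Generates w o) hsub).mp h)
          have key : ∀ i, ∃ t, G.Generates (ss (θ i).2) (φ.apply t) ∧ B.Accepts (θ i).1 t ∧
              ∀ l, vs l = Sum.inr i → ψ.apply t = os l := by
            intro i
            obtain ⟨l, hl, hl'⟩ := hψ.existsUnique_of_onSym_eq hh i
            obtain ⟨t, ht1, ht2, ht3⟩ := ih.2 h' _ os hsub rfl l (ss (θ i).2) (θ i).1
              (by simp only [hl, Sum.elim_inr, Equiv.symm_apply_apply])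
            exact ⟨t, ht1, ht2, fun l' h => by rw [hl' l' h, ht3]⟩
          choose ts ht1 ht2 ht3 using key
          refine ⟨.node f ts, ?_, TreeAutomaton.accepts_node_iff.2 ⟨_, hp, ht2⟩, ?_⟩
          · rw [TreeHom.apply_node_of_onSym_eq hg]
            refine .terminal g _ _ (fun j => ?_)
            cases hj : us j with
            | inl v => exact (mem_leafSet_iff he).1 (hv j v hj)
            | inr i =>
              rw [(hφ.existsUnique_of_onSym_eq hg i).unique hj (hpos i)]
              exact ht1 i
          · rw [TreeHom.apply_node_of_onSym_eq hh]
            congr 1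
            funext l
            have := hos l
            cases hl : vs l with
            | inl y =>
              simp only [hl, Sum.elim_inl] at this
              exact (generates_leaf_iff.1 this).symm
            | inr i => exact ht3 i l hl

end ContextFreeTreeGrammar

theorem IsAlgebraicTreeLanguage.image_bimorphismRel {S : RankedAlphabet} {V : Type*} [Finite V]
    {C : RankedAlphabet.{0}} {Z : Type} [Finite Z] {D : RankedAlphabet} {Y : Type*}
    {φ : TreeHom C Z S V} {ψ : TreeHom C Z D Y} {L₀ : Set (RTree C Z)} {L : Set (RTree S V)}
    (hL : IsAlgebraicTreeLanguage L) (hφ : φ.IsQuasiAlphabetic) (hψ : ψ.IsQuasiAlphabetic)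
    (hL₀ : IsRecognizableTreeLanguage L₀) :
    IsAlgebraicTreeLanguage ((bimorphismRel φ L₀ ψ).image L) := by
  obtain ⟨G, rfl⟩ := hL
  obtain ⟨B, rfl⟩ := hL₀
  have he := (Finite.equivFin V).injective
  -- The start symbol carries one automaton state, so a single initial state is needed.
  obtain ⟨B', p₀, hp₀⟩ := B.exists_accepts_iff_mem_language
  have := B'.finite_state
  refine ⟨G.product B' φ ψ (Finite.equivFin V) p₀, ?_⟩
  ext o
  rw [ContextFreeTreeGrammar.mem_language_iff, ContextFreeTreeGrammar.product_startTree]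
  constructor
  · intro ho
    obtain ⟨t, ht1, ht2, rfl⟩ :=
      (ContextFreeTreeGrammar.exists_of_generates_translateClosed hφ hψ he ho).1 _ _ rfl
    exact ⟨φ.apply t, ContextFreeTreeGrammar.mem_language_iff.2 ht1, t,
      (hp₀ t).1 ht2, rfl⟩
  · rintro ⟨s, hs, t, ht, h⟩
    cases h
    exact ContextFreeTreeGrammar.generates_translateClosed_of hφ hψ he
      (ContextFreeTreeGrammar.mem_language_iff.1 hs) ((hp₀ t).2 ht)

theorem mainTheorem7 {S : RankedAlphabet} {V : Type*} [Finite V] {D : RankedAlphabet} {Y : Type*}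
    [Finite Y] (τ : SetRel (RTree S V) (RTree D Y)) (hτ : IsQuasiAlphabeticRel τ) :
    (∀ L : Set (RTree S V), IsRecognizableTreeLanguage L → IsRecognizableTreeLanguage (τ.image L)) ∧
      (∀ L : Set (RTree S V), IsAlgebraicTreeLanguage L → IsAlgebraicTreeLanguage (τ.image L)) := by
  obtain ⟨C, Z, _, φ, L₀, ψ, hφ, hL₀, hψ, rfl⟩ := hτ
  exact ⟨fun L hL => hL.image_bimorphismRel hφ hψ hL₀, fun L hL => hL.image_bimorphismRel hφ hψ hL₀⟩
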